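/- Let $C\subset\mathbb R^2$ be an $o$-symmetric plane convex body, i.e. a compact convex set with non-empty interior and $C=-C$. Let $\|\cdot\|_C$ be the norm with unit disk $C$. The $C$-length of a polygonal curve is the sum of the $\|\cdot\|_C$-distances between consecutive vertices, and the $C$-length of a curve is the supremum of the $C$-lengths of the polygonal curves whose vertices are chosen, in order, from the curve. Let $\operatorname{perim}_C(C)$ be the $C$-length of the boundary $\partial C$. For points $p,q\in\mathbb R^2$ with $\|p-q\|_C\le 2$, let the arc-distance $\operatorname{arclength}_C(p,q)$ be the minimum of the $C$-lengths of the arcs with endpoints $p$ and $q$ that are contained in $\partial(y+C)$ for some $y\in\mathbb R^2$ (a single point counts as an arc from $p$ to $p$, so that $\operatorname{arclength}_C(p,p)=0$). Then for every real $\rho$ with $0\le\rho\le\frac12\operatorname{perim}_C(C)$, the arc-distance disk $$\Delta_C(\rho)=\{w\in\mathbb R^2:\ \|w\|_C\le 2,\ \operatorname{arclength}_C(o,w)\le\rho\}$$ is convex. -/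

import Mathlib

open Set
open scoped ENNReal Pointwise

noncomputable section

/-- The Euclidean plane. -/
abbrev Plane := EuclideanSpace ℝ (Fin 2)

/-- The `C`-distance of two points, i.e. the distance in the norm with unit disk `C`
(for an `o`-symmetric plane convex body `C`). -/
def cDist (C : Set Plane) (p q : Plane) : ℝ := gauge C (q - p)

/-- The `C`-length of the curve `γ : [a, b] → ℝ²`: the supremum of the `C`-lengths of the
polygonal curves whose vertices are chosen, in order, from the curve. -/
def cLength (C : Set Plane) (γ : ℝ → Plane) (a b : ℝ) : ℝ≥0∞ :=
  ⨆ (n : ℕ) (t : ℕ → ℝ) (_ : Monotone t) (_ : ∀ i, t i ∈ Icc a b),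
    ∑ i ∈ Finset.range n, ENNReal.ofReal (cDist C (γ (t i)) (γ (t (i + 1))))

/-- `γ`, restricted to `[a, b]`, is a simple closed curve whose trace is `S`. -/
structure IsSimpleClosedCurve (γ : ℝ → Plane) (a b : ℝ) (S : Set Plane) : Prop where
  lt : a < b
  continuousOn : ContinuousOn γ (Icc a b)
  injOn : InjOn γ (Ico a b)
  closed : γ a = γ b
  image_eq : γ '' Icc a b = S

/-- The perimeter of `D` with respect to `C`: the `C`-length of the boundary of `D`.
All simple closed parametrizations of the boundary of a plane convex body have the same length,
so that the infimum over the parametrizations is their common value. -/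
def perim (C D : Set Plane) : ℝ≥0∞ :=
  ⨅ (γ : ℝ → Plane) (a : ℝ) (b : ℝ) (_ : IsSimpleClosedCurve γ a b (frontier D)),
    cLength C γ a b

/-- `γ`, restricted to `[a, b]`, parametrizes an arc (an injective continuous image of a compact
interval, which may degenerate to a point) with endpoints `p` and `q` that is contained in `S`. -/
structure IsArcIn (S : Set Plane) (γ : ℝ → Plane) (a b : ℝ) (p q : Plane) : Prop where
  le : a ≤ b
  continuousOn : ContinuousOn γ (Icc a b)
  injOn : InjOn γ (Icc a b)
  source : γ a = p
  target : γ b = q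
  mapsTo : MapsTo γ (Icc a b) S

/-- The arc-distance of `p` and `q` with respect to `C`: the least `C`-length of an arc with
endpoints `p` and `q` that is contained in the boundary of some translate `y + C`.
It is `⊤` if there is no such arc. -/
def arcDist (C : Set Plane) (p q : Plane) : ℝ≥0∞ :=
  ⨅ (y : Plane) (γ : ℝ → Plane) (a : ℝ) (b : ℝ) (_ : IsArcIn (frontier (y +ᵥ C)) γ a b p q),
    cLength C γ a b

/-- The arc-distance disk with respect to `C` of center `z` and radius `ρ`; arc-distance is
defined for points at `C`-distance at most two. -/
def arcDisk (C : Set Plane) (z : Plane) (ρ : ℝ) : Set Plane :=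
  {w | cDist C z w ≤ 2 ∧ arcDist C z w ≤ ENNReal.ofReal ρ}

end

/-! Norm the plane by the gauge of `C`. An arc of a translated unit circle enters the problem only
through the difference of its endpoints and its length, so the disk becomes the set `arcVectors` of
endpoint differences of positively oriented arcs of length at most `ρ`. Central symmetry turns
negatively oriented arcs into positively oriented ones.

Convexity comes from separation by calibrations. Let `w` be nonzero, `‖w‖ < 2`, and write it as a
chord from angle `α` to `β` (`exists_chord_eq`). `exists_calibration` gives a linear `f` that
dominates the norm on chords inside the arc from `α` to `β` and is dominated by it on chords inside
each of two half circles covering the complementary arc. Hence `f` of the endpoint difference minus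
the arc length is largest on this arc (`calibration_sub_arcLen_le`). If its length exceeds `ρ`, then
`f` is strictly larger at `w` than anywhere on `arcVectors` (`exists_separating_of_notMem`). Norm 2
is reached by closedness, in `convex_arcVectors`. -/

section UnitCurve

/-! ### Angular parametrization of the unit circle and its arc length -/

variable {E : Type*} [NormedAddCommGroup E] [NormedSpace ℝ E] (Φ : E ≃L[ℝ] ℂ)

/-- The vector with coordinate `exp (i θ)`. -/
noncomputable def ray (θ : ℝ) : E := Φ.symm (Complex.exp (θ * Complex.I))

/-- The point of the unit circle of `E` in the direction of angle `θ`. -/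
noncomputable def unitPt (θ : ℝ) : E := ‖ray Φ θ‖⁻¹ • ray Φ θ

theorem ray_ne_zero (θ : ℝ) : ray Φ θ ≠ 0 := by
  simp [ray]

theorem norm_ray_pos (θ : ℝ) : 0 < ‖ray Φ θ‖ := norm_pos_iff.2 (ray_ne_zero Φ θ)

theorem norm_unitPt (θ : ℝ) : ‖unitPt Φ θ‖ = 1 := by
  rw [unitPt, norm_smul, norm_inv, norm_norm, inv_mul_cancel₀ (norm_ray_pos Φ θ).ne']

theorem ray_eq_smul_unitPt (θ : ℝ) : ray Φ θ = ‖ray Φ θ‖ • unitPt Φ θ := by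
  rw [unitPt, smul_smul, mul_inv_cancel₀ (norm_ray_pos Φ θ).ne', one_smul]

theorem ray_add_pi (θ : ℝ) : ray Φ (θ + Real.pi) = -ray Φ θ := by
  simp [ray, add_mul, Complex.exp_add]

theorem unitPt_add_pi (θ : ℝ) : unitPt Φ (θ + Real.pi) = -unitPt Φ θ := by
  simp [unitPt, ray_add_pi]

theorem unitPt_periodic : Function.Periodic (unitPt Φ) (2 * Real.pi) := fun θ ↦ by
  rw [two_mul, ← add_assoc, unitPt_add_pi, unitPt_add_pi, neg_neg]

theorem ray_three_term (a x y : ℝ) :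
    Real.sin (y - a) • ray Φ x = Real.sin (y - x) • ray Φ a + Real.sin (x - a) • ray Φ y := by
  simp only [ray, ← map_smul, ← map_add]
  congr 1
  apply Complex.ext <;>
    simp only [Complex.smul_re, Complex.smul_im, Complex.add_re, Complex.add_im, smul_eq_mul,
      Complex.exp_ofReal_mul_I_re, Complex.exp_ofReal_mul_I_im, Real.sin_sub] <;> ring

theorem unitPt_eq_of_norm_eq_one {z : E} (hz : ‖z‖ = 1) (θ : ℝ)
    (hθ : Φ z = ‖Φ z‖ * Complex.exp (θ * Complex.I)) : unitPt Φ θ = z := by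
  have hz0 : z ≠ 0 := by rintro rfl; simp at hz
  have h0 : 0 < ‖Φ z‖ := by simpa using hz0
  have h1 : z = ‖Φ z‖ • ray Φ θ := by
    apply Φ.injective
    rw [map_smul, ray, Φ.apply_symm_apply, Complex.real_smul]
    exact hθ
  have h2 : ‖Φ z‖ * ‖ray Φ θ‖ = 1 := by
    rw [← hz]
    conv_rhs => rw [h1]
    rw [norm_smul, norm_norm]
  rw [unitPt, ← eq_inv_of_mul_eq_one_left h2]
  exact h1.symm

theorem exists_unitPt_eq {z : E} (hz : ‖z‖ = 1) (a : ℝ) :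
    ∃ θ ∈ Ioc (a - Real.pi) (a + Real.pi), unitPt Φ θ = z := by
  obtain ⟨θ, hθ, h⟩ := (unitPt_periodic Φ).exists_mem_Ioc Real.two_pi_pos
    (Complex.arg (Φ z)) (a - Real.pi)
  refine ⟨θ, ⟨hθ.1, by linarith [hθ.2]⟩, ?_⟩
  rw [← h]
  exact unitPt_eq_of_norm_eq_one Φ hz _ (Complex.norm_mul_exp_arg_mul_I _).symm

theorem norm_ray_sub_le (x y : ℝ) :
    ‖ray Φ x - ray Φ y‖ ≤ ‖(Φ.symm : ℂ →L[ℝ] E)‖ * |x - y| := by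
  have h : ‖Complex.exp (x * Complex.I) - Complex.exp (y * Complex.I)‖ ≤ |x - y| := by
    have : Complex.exp (x * Complex.I) - Complex.exp (y * Complex.I)
        = Complex.exp (y * Complex.I) * (Complex.exp (Complex.I * ((x - y : ℝ) : ℂ)) - 1) := by
      rw [mul_sub, ← Complex.exp_add, mul_one]
      congr 2
      push_cast
      ring
    rw [this, norm_mul, Complex.norm_exp_ofReal_mul_I, one_mul]
    exact Real.norm_exp_I_mul_ofReal_sub_one_le
  rw [ray, ray, ← map_sub]
  exact ((Φ.symm : ℂ →L[ℝ] E).le_opNorm _).trans (by gcongr)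

theorem inv_norm_ray_le (θ : ℝ) : ‖ray Φ θ‖⁻¹ ≤ ‖(Φ : E →L[ℝ] ℂ)‖ := by
  have h := (Φ : E →L[ℝ] ℂ).le_opNorm (ray Φ θ)
  have h1 : ‖(Φ : E →L[ℝ] ℂ) (ray Φ θ)‖ = 1 := by
    simp [ray, Complex.norm_exp_ofReal_mul_I]
  rw [h1] at h
  rwa [inv_eq_one_div, div_le_iff₀ (norm_ray_pos Φ θ)]

/-- Makes every arc length finite, and arc length continuous in the angles. -/
theorem exists_lipschitzWith_unitPt : ∃ K, LipschitzWith K (unitPt Φ) := by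
  refine ⟨_, LipschitzWith.of_dist_le_mul (K := 2 * (‖(Φ : E →L[ℝ] ℂ)‖₊ *
    ‖(Φ.symm : ℂ →L[ℝ] E)‖₊)) fun x y ↦ ?_⟩
  have e : unitPt Φ x - unitPt Φ y = ‖ray Φ x‖⁻¹ • (ray Φ x - ray Φ y)
      + (‖ray Φ x‖⁻¹ * (‖ray Φ y‖ - ‖ray Φ x‖)) • unitPt Φ y := by
    have hx := (norm_ray_pos Φ x).ne'
    have hy := (norm_ray_pos Φ y).ne'
    rw [unitPt, unitPt, smul_sub, smul_smul, mul_sub, inv_mul_cancel₀ hx, sub_mul, mul_assoc,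
      mul_inv_cancel₀ hy, sub_smul, mul_one, one_mul]
    abel
  have hx := inv_nonneg.2 (norm_ray_pos Φ x).le
  have h1 := norm_ray_sub_le Φ x y
  have h2 := inv_norm_ray_le Φ x
  have h3 : |‖ray Φ y‖ - ‖ray Φ x‖| ≤ ‖ray Φ x - ray Φ y‖ := by
    rw [abs_sub_comm]; exact abs_norm_sub_norm_le _ _
  rw [dist_eq_norm, e, Real.dist_eq]
  calc _ ≤ ‖ray Φ x‖⁻¹ * ‖ray Φ x - ray Φ y‖ + ‖ray Φ x‖⁻¹ * ‖ray Φ x - ray Φ y‖ := by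
        refine (norm_add_le _ _).trans ?_
        rw [norm_smul, norm_smul, norm_unitPt, norm_mul, mul_one, norm_inv, norm_norm,
          Real.norm_eq_abs]
        gcongr
    _ ≤ 2 * (‖(Φ : E →L[ℝ] ℂ)‖ * (‖(Φ.symm : ℂ →L[ℝ] E)‖ * |x - y|)) := by
        rw [← two_mul]
        gcongr
    _ = _ := by push_cast; ring

theorem continuous_unitPt : Continuous (unitPt Φ) :=
  (exists_lipschitzWith_unitPt Φ).choose_spec.continuous

/-- The oriented area form in the coordinates `Φ`. -/
noncomputable def planeCross (z z' : E) : ℝ := (Φ z).re * (Φ z').im - (Φ z).im * (Φ z').re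

theorem planeCross_unitPt (x y : ℝ) : planeCross Φ (unitPt Φ x) (unitPt Φ y)
    = ‖ray Φ x‖⁻¹ * ‖ray Φ y‖⁻¹ * Real.sin (y - x) := by
  simp [planeCross, unitPt, ray, Complex.exp_ofReal_mul_I_re, Complex.exp_ofReal_mul_I_im,
    Real.sin_sub]
  ring

theorem planeCross_unitPt_nonneg {x y : ℝ} (h : x ≤ y) (h' : y ≤ x + Real.pi) :
    0 ≤ planeCross Φ (unitPt Φ x) (unitPt Φ y) := by
  rw [planeCross_unitPt]
  have := Real.sin_nonneg_of_nonneg_of_le_pi (x := y - x) (by linarith) (by linarith)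
  positivity

theorem planeCross_add_smul (z u w : E) (r s : ℝ) :
    planeCross Φ z (r • u + s • w) = r * planeCross Φ z u + s * planeCross Φ z w := by
  simp [planeCross]; ring

theorem planeCross_self (z : E) : planeCross Φ z z = 0 := by
  simp [planeCross]; ring

/-- Cramer's rule, kept free of division. -/
theorem planeCross_smul_eq (u v z : E) :
    planeCross Φ u v • z = planeCross Φ z v • u + planeCross Φ u z • v := by
  apply Φ.injective
  simp only [map_smul, map_add]
  apply Complex.ext <;> simp [planeCross] <;> ring

/-- The length of the unit circle between two angles. -/
noncomputable def arcLen (x y : ℝ) : ℝ := (eVariationOn (unitPt Φ) (Icc x y)).toReal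

theorem exists_eVariationOn_unitPt_le : ∃ K : ℝ, ∀ x y : ℝ, x ≤ y →
    eVariationOn (unitPt Φ) (Icc x y) ≤ ENNReal.ofReal (K * (y - x)) := by
  obtain ⟨K, hK⟩ := exists_lipschitzWith_unitPt Φ
  refine ⟨K, fun x y hxy ↦ ?_⟩
  have h := (hK.lipschitzOnWith (s := univ)).comp_eVariationOn_le (g := id) (s := Icc x y)
    (fun _ _ ↦ mem_univ _)
  have h2 := (monotone_id (α := ℝ)).monotoneOn (Icc x y) |>.eVariationOn_eq
    (left_mem_Icc.2 hxy) (right_mem_Icc.2 hxy)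
  rw [inter_self] at h2
  refine h.trans ((mul_le_mul_right h2.le _).trans ?_)
  rw [ENNReal.ofReal_mul K.coe_nonneg, ENNReal.ofReal_coe_nnreal]
  exact le_rfl

theorem eVariationOn_unitPt_ne_top (x y : ℝ) : eVariationOn (unitPt Φ) (Icc x y) ≠ ⊤ := by
  obtain ⟨K, hK⟩ := exists_eVariationOn_unitPt_le Φ
  rcases le_total x y with h | h
  · exact ((hK x y h).trans_lt ENNReal.ofReal_lt_top).ne
  · rw [eVariationOn.subsingleton _ (subsingleton_Icc_of_ge h)]
    simp

theorem ofReal_arcLen (x y : ℝ) :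
    ENNReal.ofReal (arcLen Φ x y) = eVariationOn (unitPt Φ) (Icc x y) :=
  ENNReal.ofReal_toReal (eVariationOn_unitPt_ne_top Φ x y)

theorem arcLen_nonneg (x y : ℝ) : 0 ≤ arcLen Φ x y := ENNReal.toReal_nonneg

theorem arcLen_self (x : ℝ) : arcLen Φ x x = 0 := by
  rw [arcLen, eVariationOn.subsingleton _ (by simp)]
  simp

theorem arcLen_add {x y z : ℝ} (h : x ≤ y) (h' : y ≤ z) :
    arcLen Φ x y + arcLen Φ y z = arcLen Φ x z := by
  have := eVariationOn.Icc_add_Icc (unitPt Φ) (s := univ) h h' (mem_univ _)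
  simp only [univ_inter] at this
  rw [arcLen, arcLen, arcLen, ← ENNReal.toReal_add (eVariationOn_unitPt_ne_top Φ _ _)
    (eVariationOn_unitPt_ne_top Φ _ _), this]

theorem exists_arcLen_le : ∃ K : ℝ, ∀ x y : ℝ, x ≤ y → arcLen Φ x y ≤ K * (y - x) := by
  obtain ⟨K, hK⟩ := exists_eVariationOn_unitPt_le Φ
  refine ⟨max K 0, fun x y h ↦ ENNReal.toReal_le_of_le_ofReal
    (mul_nonneg (le_max_right _ _) (sub_nonneg.2 h)) ((hK x y h).trans ?_)⟩
  exact ENNReal.ofReal_le_ofReal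
    (mul_le_mul_of_nonneg_right (le_max_left _ _) (sub_nonneg.2 h))

theorem norm_sub_le_arcLen {x y : ℝ} (h : x ≤ y) : ‖unitPt Φ y - unitPt Φ x‖ ≤ arcLen Φ x y := by
  have := eVariationOn.edist_le (unitPt Φ) (right_mem_Icc.2 h) (left_mem_Icc.2 h)
  rw [edist_dist, dist_eq_norm] at this
  exact (ENNReal.ofReal_le_iff_le_toReal (eVariationOn_unitPt_ne_top Φ _ _)).1 this

theorem arcLen_add_pi (x y : ℝ) :
    arcLen Φ (x + Real.pi) (y + Real.pi) = arcLen Φ x y := by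
  have h := eVariationOn.comp_eq_of_monotoneOn (unitPt Φ) (t := Icc x y) (fun t ↦ t + Real.pi)
    (fun a _ b _ hab ↦ by simpa using hab)
  rw [image_add_const_Icc] at h
  rw [arcLen, arcLen, ← h]
  congr 1
  simp only [eVariationOn, Function.comp_def, unitPt_add_pi, edist_neg_neg]

theorem arcLen_add_two_pi (x y : ℝ) :
    arcLen Φ (x + 2 * Real.pi) (y + 2 * Real.pi) = arcLen Φ x y := by
  rw [two_mul, ← add_assoc, ← add_assoc, arcLen_add_pi, arcLen_add_pi]

/-- The hypothesis makes `f` monotone along the curve, so its variation there is just the difference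
of its end values, and it bounds each polygonal sum term by term. -/
theorem arcLen_le_of_norm_le {f : E →ₗ[ℝ] ℝ} {a b : ℝ}
    (hf : ∀ x y, a ≤ x → x ≤ y → y ≤ b →
      ‖unitPt Φ y - unitPt Φ x‖ ≤ f (unitPt Φ y - unitPt Φ x)) {x y : ℝ}
    (hx : a ≤ x) (hxy : x ≤ y) (hy : y ≤ b) : arcLen Φ x y ≤ f (unitPt Φ y) - f (unitPt Φ x) := by
  have mono : MonotoneOn (fun t ↦ f (unitPt Φ t)) (Icc x y) := fun s hs t ht hst ↦ by
    have := (norm_nonneg _).trans (hf s t (hx.trans hs.1) hst (ht.2.trans hy))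
    rw [map_sub] at this
    exact sub_nonneg.1 this
  have h := mono.eVariationOn_eq (left_mem_Icc.2 hxy) (right_mem_Icc.2 hxy)
  rw [inter_self] at h
  have h0 := mono (left_mem_Icc.2 hxy) (right_mem_Icc.2 hxy) hxy
  refine ENNReal.toReal_le_of_le_ofReal (sub_nonneg.2 h0) (le_trans ?_ h.le)
  refine iSup_le fun p ↦ le_trans ?_ (eVariationOn.sum_le (n := p.1) p.2.2.1 p.2.2.2)
  refine Finset.sum_le_sum fun i _ ↦ ?_
  have h1 := hf (p.2.1 i) (p.2.1 (i + 1)) (hx.trans (p.2.2.2 i).1) (p.2.2.1 (Nat.le_succ i))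
    ((p.2.2.2 (i + 1)).2.trans hy)
  rw [edist_dist, edist_dist, dist_eq_norm, Real.dist_eq, ← map_sub]
  exact ENNReal.ofReal_le_ofReal (h1.trans (le_abs_self _))

end UnitCurve

/-! ### Support functionals, chords and calibrations -/

section Chord

variable {E : Type*} [NormedAddCommGroup E] [NormedSpace ℝ E] (Φ : E ≃L[ℝ] ℂ)

/-- A support functional decreases along the half circle that starts at its contact point. With `D •
X = A • U + B • Y` for the points at angles `x`, `a`, `y`, one gets `D * (h X - h Y) = A + (B - D) *
h Y`, where `|B - D| ≤ A` by the triangle inequality and `|h Y| ≤ 1`. -/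
theorem support_le_of_le {h : E →ₗ[ℝ] ℝ} (hh : ∀ z, h z ≤ ‖z‖) {a x y : ℝ}
    (ha : h (unitPt Φ a) = 1) (hax : a ≤ x) (hxy : x ≤ y) (hy : y ≤ a + Real.pi) :
    h (unitPt Φ y) ≤ h (unitPt Φ x) := by
  have hlow : ∀ z, -‖z‖ ≤ h z := fun z ↦ by
    have := hh (-z); rw [map_neg, norm_neg] at this; linarith
  have hY := hh (unitPt Φ y)
  have hY' := hlow (unitPt Φ y)
  have hX' := hlow (unitPt Φ x)
  rw [norm_unitPt] at hY hY' hX'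
  rcases (hax.trans hxy).eq_or_lt with rfl | h1
  · rw [le_antisymm hxy hax]
  rcases hy.eq_or_lt with rfl | h2
  · rwa [unitPt_add_pi, map_neg, ha]
  have hS : 0 < Real.sin (y - a) := Real.sin_pos_of_pos_of_lt_pi (by linarith) (by linarith)
  have hA : 0 ≤ Real.sin (y - x) :=
    Real.sin_nonneg_of_nonneg_of_le_pi (by linarith) (by linarith)
  have hB : 0 ≤ Real.sin (x - a) :=
    Real.sin_nonneg_of_nonneg_of_le_pi (by linarith) (by linarith)
  have key := ray_three_term Φ a x y
  rw [ray_eq_smul_unitPt Φ x, ray_eq_smul_unitPt Φ y, ray_eq_smul_unitPt Φ a, smul_smul,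
    smul_smul, smul_smul] at key
  have hD := mul_pos hS (norm_ray_pos Φ x)
  replace hA := mul_nonneg hA (norm_ray_pos Φ a).le
  replace hB := mul_nonneg hB (norm_ray_pos Φ y).le
  set D := Real.sin (y - a) * ‖ray Φ x‖
  set A := Real.sin (y - x) * ‖ray Φ a‖
  set B := Real.sin (x - a) * ‖ray Φ y‖
  have e1 : D ≤ A + B := by
    have : ‖D • unitPt Φ x‖ ≤ ‖A • unitPt Φ a‖ + ‖B • unitPt Φ y‖ := by
      rw [key]; exact norm_add_le _ _
    simpa [norm_smul, norm_unitPt, abs_of_nonneg, hA, hB, hD.le] using this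
  have e2 : B ≤ D + A := by
    have : ‖B • unitPt Φ y‖ ≤ ‖D • unitPt Φ x‖ + ‖A • unitPt Φ a‖ := by
      rw [← sub_eq_iff_eq_add'.2 key]; exact norm_sub_le _ _
    simpa [norm_smul, norm_unitPt, abs_of_nonneg, hA, hB, hD.le] using this
  have e3 : D * h (unitPt Φ x) = A + B * h (unitPt Φ y) := by
    have := congrArg h key
    simpa [ha] using this
  have e4 : 0 ≤ D * (h (unitPt Φ x) - h (unitPt Φ y)) := by
    rw [mul_sub, e3]
    nlinarith [mul_nonneg (sub_nonneg.2 e1) (neg_le_iff_add_nonneg.1 hY'),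
      mul_nonneg (sub_nonneg.2 e2) (neg_le_iff_add_nonneg.1 hY'),
      mul_nonneg (sub_nonneg.2 e1) (sub_nonneg.2 hY),
      mul_nonneg (sub_nonneg.2 e2) (sub_nonneg.2 hY)]
  exact sub_nonneg.1 (nonneg_of_mul_nonneg_right e4 hD)

theorem le_support_of_le {h : E →ₗ[ℝ] ℝ} (hh : ∀ z, h z ≤ ‖z‖) {a x y : ℝ}
    (ha : h (unitPt Φ a) = 1) (hax : a - Real.pi ≤ x) (hxy : x ≤ y) (hy : y ≤ a) :
    h (unitPt Φ x) ≤ h (unitPt Φ y) := by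
  have := support_le_of_le Φ hh ha (x := x + Real.pi) (y := y + Real.pi)
    (by linarith) (by linarith) (by linarith)
  rw [unitPt_add_pi, unitPt_add_pi, map_neg, map_neg] at this
  linarith

theorem exists_support (z : E) : ∃ h : E →ₗ[ℝ] ℝ, (∀ z, h z ≤ ‖z‖) ∧ h z = ‖z‖ := by
  obtain ⟨g, hg, hz⟩ := exists_dual_vector'' ℝ z
  refine ⟨g, fun x ↦ ?_, hz⟩
  calc g x ≤ ‖g x‖ := le_abs_self _
    _ ≤ ‖g‖ * ‖x‖ := g.le_opNorm x
    _ ≤ 1 * ‖x‖ := by gcongr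
    _ = ‖x‖ := one_mul _

theorem exists_chord_eq {w : E} (hw0 : w ≠ 0) (hw : ‖w‖ < 2) :
    ∃ α β, α < β ∧ β < α + Real.pi ∧ unitPt Φ β - unitPt Φ α = w := by
  have hn : 0 < ‖w‖ := norm_pos_iff.2 hw0
  obtain ⟨φ, -, hφ⟩ := exists_unitPt_eq Φ (z := ‖w‖⁻¹ • w)
    (by rw [norm_smul, norm_inv, norm_norm, inv_mul_cancel₀ hn.ne']) 0
  have hwφ : w = ‖w‖ • unitPt Φ φ := by
    rw [hφ, smul_smul, mul_inv_cancel₀ hn.ne', one_smul]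
  have hcont : ContinuousOn (fun θ ↦ ‖unitPt Φ θ + w‖) (Icc (φ - Real.pi) φ) :=
    ((continuous_unitPt Φ).add continuous_const).norm.continuousOn
  have hleft : ‖unitPt Φ (φ - Real.pi) + w‖ ≤ 1 := by
    have : unitPt Φ (φ - Real.pi) = -unitPt Φ φ := by
      rw [← neg_neg (unitPt Φ (φ - Real.pi)), ← unitPt_add_pi, sub_add_cancel]
    have e : unitPt Φ (φ - Real.pi) + w = (‖w‖ - 1) • unitPt Φ φ := by
      rw [this, sub_smul, one_smul, ← hwφ]; abel
    rw [e, norm_smul, norm_unitPt, mul_one, Real.norm_eq_abs, abs_le]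
    constructor <;> linarith
  have hright : 1 ≤ ‖unitPt Φ φ + w‖ := by
    have e : unitPt Φ φ + w = (1 + ‖w‖) • unitPt Φ φ := by
      rw [add_smul, one_smul, ← hwφ]
    rw [e, norm_smul, norm_unitPt, mul_one, Real.norm_eq_abs, abs_of_pos (by linarith)]
    linarith
  -- As the start of the chord turns from the direction of `-w` to that of `w`, the norm of its tip
  -- passes through 1.
  obtain ⟨α, hα, h1⟩ := intermediate_value_Icc (by linarith [Real.pi_pos]) hcont ⟨hleft, hright⟩
  obtain ⟨β, hβ, hv⟩ := exists_unitPt_eq Φ h1 α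
  -- The start lies at most a half turn before the direction of `w`, which forces the chord to be
  -- positively oriented.
  have hcr : planeCross Φ (unitPt Φ α) (unitPt Φ β)
      = ‖w‖ * planeCross Φ (unitPt Φ α) (unitPt Φ φ) := by
    have := planeCross_add_smul Φ (unitPt Φ α) (unitPt Φ α) (unitPt Φ φ) 1 ‖w‖
    rwa [one_smul, ← hwφ, planeCross_self, mul_zero, zero_add, ← hv] at this
  have hsin : 0 ≤ Real.sin (β - α) := by
    have h2 : 0 ≤ planeCross Φ (unitPt Φ α) (unitPt Φ β) := by
      rw [hcr]
      exact mul_nonneg hn.le (planeCross_unitPt_nonneg Φ hα.2 (by linarith [hα.1]))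
    rw [planeCross_unitPt] at h2
    exact nonneg_of_mul_nonneg_right h2
      (mul_pos (inv_pos.2 (norm_ray_pos Φ α)) (inv_pos.2 (norm_ray_pos Φ β)))
  have hw' : unitPt Φ β - unitPt Φ α = w := by rw [hv]; abel
  refine ⟨α, β, lt_of_le_of_ne ?_ ?_, lt_of_le_of_ne hβ.2 ?_, hw'⟩
  · by_contra! hlt
    exact absurd (Real.sin_neg_of_neg_of_neg_pi_lt (by linarith) (by linarith [hβ.1]))
      (not_lt.2 hsin)
  · rintro rfl
    exact hw0 (by rw [← hw', sub_self])
  · rintro rfl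
    rw [unitPt_add_pi] at hw'
    have e : w = (-2 : ℝ) • unitPt Φ α := by rw [← hw', neg_smul, two_smul]; abel
    rw [e, norm_smul, norm_unitPt] at hw
    norm_num at hw

theorem planeCross_unitPt_pos {α β : ℝ} (h : α < β) (h' : β < α + Real.pi) :
    0 < planeCross Φ (unitPt Φ α) (unitPt Φ β) := by
  rw [planeCross_unitPt]
  have := Real.sin_pos_of_pos_of_lt_pi (x := β - α) (by linarith) (by linarith)
  have h1 := norm_ray_pos Φ α
  have h2 := norm_ray_pos Φ β
  positivity

/-- Take support functionals `h₁`, `h₂` at the chord's ends `u`, `v`. The tangent directions `D₁`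
and `D₂`, in their kernels, span a cone containing all forward chords of the arc. The functional
equal to the norm on `D₁` and on `D₂` is, by the triangle inequality, at least the norm on this
cone, and at most the norm once either coordinate is nonpositive. -/
theorem exists_calibration {α β : ℝ} (hαβ : α < β) (hβα : β < α + Real.pi)
    (hlt : ‖unitPt Φ β - unitPt Φ α‖ < 2) :
    ∃ f : E →ₗ[ℝ] ℝ,
      (∀ x y, α ≤ x → x ≤ y → y ≤ β →
        ‖unitPt Φ y - unitPt Φ x‖ ≤ f (unitPt Φ y - unitPt Φ x)) ∧
      (∀ x y, β ≤ x → x ≤ y → y ≤ β + Real.pi →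
        f (unitPt Φ y - unitPt Φ x) ≤ ‖unitPt Φ y - unitPt Φ x‖) ∧
      (∀ x y, α + Real.pi ≤ x → x ≤ y → y ≤ α + 2 * Real.pi →
        f (unitPt Φ y - unitPt Φ x) ≤ ‖unitPt Φ y - unitPt Φ x‖) := by
  obtain ⟨h₁, hh₁, hu⟩ := exists_support (unitPt Φ α)
  obtain ⟨h₂, hh₂, hv⟩ := exists_support (unitPt Φ β)
  rw [norm_unitPt] at hu hv
  have hdet := planeCross_unitPt_pos Φ hαβ hβα
  have hspan := planeCross_smul_eq Φ (unitPt Φ α) (unitPt Φ β)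
  have hp1 : h₁ (unitPt Φ β) ≤ 1 := by simpa [norm_unitPt] using hh₁ (unitPt Φ β)
  have hq1 : h₂ (unitPt Φ α) ≤ 1 := by simpa [norm_unitPt] using hh₂ (unitPt Φ α)
  have hp : -1 < h₁ (unitPt Φ β) := by
    have := hh₁ (-(unitPt Φ β - unitPt Φ α))
    rw [norm_neg, map_neg, map_sub, hu] at this
    linarith
  have hq : -1 < h₂ (unitPt Φ α) := by
    have := hh₂ (unitPt Φ β - unitPt Φ α)
    rw [map_sub, hv] at this
    linarith
  have mono₁ : ∀ x y, α ≤ x → x ≤ y → y ≤ α + Real.pi →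
      h₁ (unitPt Φ y - unitPt Φ x) ≤ 0 := fun x y hx hxy hy ↦ by
    rw [map_sub, sub_nonpos]; exact support_le_of_le Φ hh₁ hu hx hxy hy
  have mono₁' : ∀ x y, α + Real.pi ≤ x → x ≤ y → y ≤ α + 2 * Real.pi →
      0 ≤ h₁ (unitPt Φ y - unitPt Φ x) := fun x y hx hxy hy ↦ by
    rw [map_sub, sub_nonneg]
    exact le_support_of_le Φ hh₁ (by rw [unitPt_periodic, hu]) (by linarith) hxy hy
  have mono₂ : ∀ x y, α ≤ x → x ≤ y → y ≤ β →
      0 ≤ h₂ (unitPt Φ y - unitPt Φ x) := fun x y hx hxy hy ↦ by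
    rw [map_sub, sub_nonneg]; exact le_support_of_le Φ hh₂ hv (by linarith) hxy hy
  have mono₂' : ∀ x y, β ≤ x → x ≤ y → y ≤ β + Real.pi →
      h₂ (unitPt Φ y - unitPt Φ x) ≤ 0 := fun x y hx hxy hy ↦ by
    rw [map_sub, sub_nonpos]; exact support_le_of_le Φ hh₂ hv hx hxy hy
  set u := unitPt Φ α with hu_def
  set v := unitPt Φ β with hv_def
  set p := h₁ v with hp_def
  set q := h₂ u with hq_def
  -- Since `p` and `q` lie in `(-1, 1]`, the product reaches 1 only if both are 1. Otherwise the two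
  -- tangents are independent.
  rcases lt_or_ge (p * q) 1 with hpq | hpq
  · set D₁ := v - p • u with hD₁
    set D₂ := q • v - u with hD₂
    have hk : 0 < (1 - p * q)⁻¹ := inv_pos.2 (by linarith)
    have hkk : (1 - p * q)⁻¹ * (1 - p * q) = 1 := inv_mul_cancel₀ (by linarith)
    set k := (1 - p * q)⁻¹
    have hdecomp : ∀ z, z = (k * h₂ z) • D₁ + (-(k * h₁ z)) • D₂ := by
      intro z
      have hz := hspan z
      set s := planeCross Φ z v
      set t := planeCross Φ u z
      set d := planeCross Φ u v
      have e1 : d * h₁ z = s + t * p := by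
        have := congrArg h₁ hz
        simpa [hu, hp_def] using this
      have e2 : d * h₂ z = s * q + t := by
        have := congrArg h₂ hz
        simpa [hv, hq_def] using this
      have : d • z = d • ((k * h₂ z) • D₁ + (-(k * h₁ z)) • D₂) := by
        have e3 : d • ((k * h₂ z) • D₁ + (-(k * h₁ z)) • D₂)
            = (k * (d * h₁ z) - p * (k * (d * h₂ z))) • u
              + (k * (d * h₂ z) - q * (k * (d * h₁ z))) • v := by
          rw [hD₁, hD₂]; module
        rw [e3, e1, e2, hz]
        congr 2
        · linear_combination (-s) * hkk
        · linear_combination (-t) * hkk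
      exact smul_right_injective E hdet.ne' this
    -- By `hdecomp`, this is the functional with values `‖D₁‖` at `D₁` and `‖D₂‖` at `D₂`.
    refine ⟨k • (‖D₁‖ • h₂ - ‖D₂‖ • h₁), ?_, ?_, ?_⟩
    · intro x y hx hxy hy
      have a1 := mono₁ x y hx hxy (by linarith)
      have a2 := mono₂ x y hx hxy hy
      generalize unitPt Φ y - unitPt Φ x = z at a1 a2 ⊢
      have b1 : 0 ≤ -(k * h₁ z) := by nlinarith
      have b2 : 0 ≤ k * h₂ z := mul_nonneg hk.le a2
      calc ‖z‖ = ‖(k * h₂ z) • D₁ + (-(k * h₁ z)) • D₂‖ := by rw [← hdecomp z]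
        _ ≤ (k * h₂ z) * ‖D₁‖ + (-(k * h₁ z)) * ‖D₂‖ := by
          refine (norm_add_le _ _).trans_eq ?_
          rw [norm_smul, norm_smul, Real.norm_of_nonneg b1, Real.norm_of_nonneg b2]
        _ = _ := by simp; ring
    · intro x y hx hxy hy
      have a2 := mono₂' x y hx hxy hy
      generalize unitPt Φ y - unitPt Φ x = z at a2 ⊢
      have b2 : k * h₂ z ≤ 0 := by nlinarith
      have hz : (-(k * h₁ z)) • D₂ = z - (k * h₂ z) • D₁ := eq_sub_of_add_eq' (hdecomp z).symm
      have h3 : ‖(-(k * h₁ z)) • D₂‖ ≤ ‖z‖ + ‖(k * h₂ z) • D₁‖ := hz ▸ norm_sub_le _ _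
      rw [norm_smul, norm_smul, Real.norm_of_nonpos b2] at h3
      have h4 := mul_le_mul_of_nonneg_right (le_abs_self (-(k * h₁ z))) (norm_nonneg D₂)
      rw [← Real.norm_eq_abs] at h4
      simp only [LinearMap.smul_apply, LinearMap.sub_apply, smul_eq_mul]
      linarith
    · intro x y hx hxy hy
      have a1 := mono₁' x y hx hxy hy
      generalize unitPt Φ y - unitPt Φ x = z at a1 ⊢
      have b1 : -(k * h₁ z) ≤ 0 := neg_nonpos.2 (mul_nonneg hk.le a1)
      have hz : (k * h₂ z) • D₁ = z - (-(k * h₁ z)) • D₂ := eq_sub_of_add_eq (hdecomp z).symm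
      have h3 : ‖(k * h₂ z) • D₁‖ ≤ ‖z‖ + ‖(-(k * h₁ z)) • D₂‖ := hz ▸ norm_sub_le _ _
      rw [norm_smul, norm_smul, Real.norm_of_nonpos b1] at h3
      have h4 := mul_le_mul_of_nonneg_right (le_abs_self (k * h₂ z)) (norm_nonneg D₁)
      rw [← Real.norm_eq_abs] at h4
      simp only [LinearMap.smul_apply, LinearMap.sub_apply, smul_eq_mul]
      linarith
  -- Degenerate case: the arc is a segment of the circle, and a norming functional of its direction
  -- calibrates it.
  · have hp_one : p = 1 := by nlinarith
    obtain ⟨f, hf, hfw⟩ := exists_support (v - u)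
    refine ⟨f, fun x y hx hxy hy ↦ ?_, fun _ _ _ _ _ ↦ hf _, fun _ _ _ _ _ ↦ hf _⟩
    have on_edge : ∀ x, α ≤ x → x ≤ β → ∃ t : ℝ, unitPt Φ x = u + t • (v - u) := by
      intro x hx hx'
      have e := mono₁ x β hx hx' hβα.le
      have e' := hh₁ (unitPt Φ x)
      rw [norm_unitPt] at e'
      rw [map_sub, ← hv_def, ← hp_def, hp_one] at e
      have hx1 : h₁ (unitPt Φ x) = 1 := by linarith
      have hz := hspan (unitPt Φ x)
      set s := planeCross Φ (unitPt Φ x) v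
      set t := planeCross Φ u (unitPt Φ x)
      set d := planeCross Φ u v
      have e1 : d = s + t := by
        have := congrArg h₁ hz
        simpa [hu, hx1, ← hp_def, hp_one] using this
      refine ⟨d⁻¹ * t, ?_⟩
      apply smul_right_injective E hdet.ne'
      change d • unitPt Φ x = d • (u + (d⁻¹ * t) • (v - u))
      rw [hz, smul_add, smul_smul, ← mul_assoc, mul_inv_cancel₀ hdet.ne', e1]
      module
    obtain ⟨r, hr⟩ := on_edge x hx (hxy.trans hy)
    obtain ⟨t, ht⟩ := on_edge y (hx.trans hxy) hy
    have hc := planeCross_unitPt_nonneg Φ hxy (by linarith)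
    have hrt : 0 ≤ t - r := by
      have e : planeCross Φ (unitPt Φ x) (unitPt Φ y) = (t - r) * planeCross Φ u v := by
        rw [hr, ht]
        simp [planeCross]
        ring
      rw [e] at hc
      exact nonneg_of_mul_nonneg_left hc hdet
    have e : unitPt Φ y - unitPt Φ x = (t - r) • (v - u) := by rw [hr, ht]; module
    rw [e, norm_smul, map_smul, hfw, smul_eq_mul, Real.norm_of_nonneg hrt]

end Chord

/-! ### Endpoint differences of bounded arcs: separation, compactness, convexity -/

section ArcVectors

variable {E : Type*} [NormedAddCommGroup E] [NormedSpace ℝ E] (Φ : E ≃L[ℝ] ℂ)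

theorem exists_shift_mem_Ico (x y a : ℝ) : ∃ t ∈ Ico (a - x) (a - x + 2 * Real.pi),
    unitPt Φ (x + t) = unitPt Φ x ∧ unitPt Φ (y + t) = unitPt Φ y ∧
      arcLen Φ (x + t) (y + t) = arcLen Φ x y := by
  have hper : Function.Periodic
      (fun t ↦ (unitPt Φ (x + t), unitPt Φ (y + t), arcLen Φ (x + t) (y + t)))
      (2 * Real.pi) := fun t ↦ by
    simp only [← add_assoc, arcLen_add_two_pi, unitPt_periodic Φ _]
  obtain ⟨t, ht, h⟩ := hper.exists_mem_Ico Real.two_pi_pos 0 (a - x)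
  simp only [add_zero, Prod.mk.injEq] at h
  exact ⟨t, ht, h.1.symm, h.2.1.symm, h.2.2.symm⟩

theorem calibration_sub_arcLen_le {α β : ℝ} {f : E →ₗ[ℝ] ℝ} (hαβ : α ≤ β)
    (hβα : β ≤ α + Real.pi)
    (hin : ∀ x y, α ≤ x → x ≤ y → y ≤ β →
      ‖unitPt Φ y - unitPt Φ x‖ ≤ f (unitPt Φ y - unitPt Φ x))
    (hout₁ : ∀ x y, β ≤ x → x ≤ y → y ≤ β + Real.pi →
      f (unitPt Φ y - unitPt Φ x) ≤ ‖unitPt Φ y - unitPt Φ x‖)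
    (hout₂ : ∀ x y, α + Real.pi ≤ x → x ≤ y → y ≤ α + 2 * Real.pi →
      f (unitPt Φ y - unitPt Φ x) ≤ ‖unitPt Φ y - unitPt Φ x‖)
    {x y : ℝ} (hxy : x ≤ y) (hyx : y ≤ x + 2 * Real.pi) :
    f (unitPt Φ y - unitPt Φ x) - arcLen Φ x y
      ≤ f (unitPt Φ β - unitPt Φ α) - arcLen Φ α β := by
  have hpi := Real.pi_pos
  obtain ⟨t, ht, h1, h2, h3⟩ := exists_shift_mem_Ico Φ x y α
  rw [← h1, ← h2, ← h3]
  replace hxy : x + t ≤ y + t := by linarith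
  replace hyx : y + t ≤ x + t + 2 * Real.pi := by linarith
  have hx0 : α ≤ x + t := by linarith [ht.1]
  have hx1 : x + t ≤ α + 2 * Real.pi := by linarith [ht.2]
  generalize x + t = x at hxy hyx hx0 hx1 ⊢
  generalize y + t = y at hxy hyx ⊢
  clear h1 h2 h3 ht
  -- The claim becomes a bound on `G y - G x`: `G` rises on `[α, β]`, falls on `[β, α + 2π]`, and
  -- drops by the whole perimeter over each period.
  set G : ℝ → ℝ := fun s ↦ f (unitPt Φ s) - arcLen Φ α s with hG
  have hGsub : ∀ r s, α ≤ r → r ≤ s →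
      G s - G r = f (unitPt Φ s - unitPt Φ r) - arcLen Φ r s := fun r s hr hrs ↦ by
    simp only [map_sub, hG, ← arcLen_add Φ hr hrs]; ring
  have hinc : ∀ r s, α ≤ r → r ≤ s → s ≤ β → G r ≤ G s := fun r s hr hrs hs ↦ by
    have := arcLen_le_of_norm_le Φ hin hr hrs hs
    have h := hGsub r s hr hrs
    rw [map_sub] at h
    linarith
  have hdec₁ : ∀ r s, β ≤ r → r ≤ s → s ≤ β + Real.pi → G s ≤ G r := fun r s hr hrs hs ↦ by
    linarith [hGsub r s (hαβ.trans hr) hrs, hout₁ r s hr hrs hs, norm_sub_le_arcLen Φ hrs]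
  have hdec₂ : ∀ r s, α + Real.pi ≤ r → r ≤ s → s ≤ α + 2 * Real.pi → G s ≤ G r :=
    fun r s hr hrs hs ↦ by
      linarith [hGsub r s (by linarith) hrs, hout₂ r s hr hrs hs, norm_sub_le_arcLen Φ hrs]
  -- The half circles starting at `β` and at `α + π` overlap and together cover the complementary
  -- arc.
  have hdec : ∀ r s, β ≤ r → r ≤ s → s ≤ α + 2 * Real.pi → G s ≤ G r := fun r s hr hrs hs ↦ by
    rcases le_total s (β + Real.pi) with h | h
    · exact hdec₁ r s hr hrs h
    rcases le_total (α + Real.pi) r with h' | h'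
    · exact hdec₂ r s h' hrs hs
    · exact (hdec₂ _ s (by linarith) h hs).trans (hdec₁ r _ hr (by linarith) le_rfl)
  have hP := arcLen_nonneg Φ α (α + 2 * Real.pi)
  have hper : ∀ s, α ≤ s → G (s + 2 * Real.pi) = G s - arcLen Φ α (α + 2 * Real.pi) :=
    fun s hs ↦ by
      simp only [hG]
      rw [unitPt_periodic, ← arcLen_add Φ (y := α + 2 * Real.pi) (by linarith) (by linarith),
        arcLen_add_two_pi]
      ring
  have hmax : ∀ s, α ≤ s → s ≤ α + 2 * Real.pi → G s ≤ G β := fun s hs hs' ↦ by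
    rcases le_total s β with h | h
    · exact hinc s β hs h le_rfl
    · exact hdec β s le_rfl h hs'
  have hmax' : ∀ s, α + 2 * Real.pi ≤ s → s ≤ α + 2 * Real.pi + 2 * Real.pi →
      G s ≤ G β - arcLen Φ α (α + 2 * Real.pi) := fun s hs hs' ↦ by
    have h := hper (s - 2 * Real.pi) (by linarith)
    rw [sub_add_cancel] at h
    linarith [hmax (s - 2 * Real.pi) (by linarith) (by linarith)]
  have hfirst := hinc α β le_rfl hαβ le_rfl
  rw [← hGsub x y hx0 hxy, ← hGsub α β le_rfl hαβ]
  rcases le_total x β with hxβ | hxβ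
  · have := hinc α x le_rfl hx0 hxβ
    rcases le_total y (α + 2 * Real.pi) with hy | hy
    · linarith [hmax y (hx0.trans hxy) hy]
    · linarith [hmax' y hy (by linarith)]
  · rcases le_total y (α + 2 * Real.pi) with hy | hy
    · linarith [hdec x y hxβ hxy hy]
    · linarith [hmax' y hy (by linarith), hdec x _ hxβ hx1 le_rfl, hper α le_rfl]

/-- The differences of endpoints of positively oriented arcs of the unit circle of length at
most `ρ`. -/
def arcVectors (ρ : ℝ) : Set E :=
  {w | ∃ x y, x ≤ y ∧ y ≤ x + 2 * Real.pi ∧ unitPt Φ y - unitPt Φ x = w ∧ arcLen Φ x y ≤ ρ}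

theorem norm_le_two_of_mem_arcVectors {ρ : ℝ} {w : E} (hw : w ∈ arcVectors Φ ρ) : ‖w‖ ≤ 2 := by
  obtain ⟨x, y, -, -, rfl, -⟩ := hw
  refine (norm_sub_le _ _).trans_eq ?_
  rw [norm_unitPt, norm_unitPt]
  norm_num

theorem zero_mem_arcVectors {ρ : ℝ} (hρ : 0 ≤ ρ) : 0 ∈ arcVectors Φ ρ :=
  ⟨0, 0, le_rfl, by linarith [Real.pi_pos], sub_self _, by rwa [arcLen_self]⟩

theorem exists_separating_of_notMem {ρ : ℝ} (hρ : 0 ≤ ρ) {w : E} (hw2 : ‖w‖ < 2)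
    (hw : w ∉ arcVectors Φ ρ) : ∃ f : E →ₗ[ℝ] ℝ, ∀ z ∈ arcVectors Φ ρ, f z < f w := by
  have hw0 : w ≠ 0 := by rintro rfl; exact hw (zero_mem_arcVectors Φ hρ)
  obtain ⟨α, β, hαβ, hβα, rfl⟩ := exists_chord_eq Φ hw0 hw2
  obtain ⟨f, hin, hout₁, hout₂⟩ := exists_calibration Φ hαβ hβα hw2
  refine ⟨f, ?_⟩
  rintro _ ⟨x, y, hxy, hyx, rfl, hL⟩
  have h := calibration_sub_arcLen_le Φ hαβ.le hβα.le hin hout₁ hout₂ hxy hyx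
  have : ρ < arcLen Φ α β := by
    by_contra! hle
    exact hw ⟨α, β, hαβ.le, by linarith [Real.pi_pos], rfl, hle⟩
  linarith

theorem continuousOn_arcLen_zero : ContinuousOn (fun t ↦ arcLen Φ 0 t) (Ici 0) := by
  obtain ⟨K, hK⟩ := exists_arcLen_le Φ
  have : LipschitzOnWith K.toNNReal (fun t ↦ arcLen Φ 0 t) (Ici 0) := by
    refine LipschitzOnWith.of_le_add_mul _ fun x hx y hy ↦ ?_
    have hK0 := mul_le_mul_of_nonneg_right (Real.le_coe_toNNReal K) (dist_nonneg (x := x) (y := y))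
    rcases le_total x y with h | h
    · have := arcLen_add Φ hx h
      have := arcLen_nonneg Φ x y
      have : 0 ≤ (K.toNNReal : ℝ) * dist x y := by positivity
      linarith
    · have h1 := arcLen_add Φ hy h
      have h2 := hK y x h
      rw [Real.dist_eq, abs_of_nonneg (sub_nonneg.2 h)] at hK0 ⊢
      linarith
  exact this.continuousOn

/-- Pairs of angles, the first of them in a fixed period, bounding a positively oriented arc. -/
def anglePairs : Set (ℝ × ℝ) :=
  {p | p.1 ∈ Icc 0 (2 * Real.pi) ∧ p.1 ≤ p.2 ∧ p.2 ≤ p.1 + 2 * Real.pi}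

theorem isCompact_anglePairs : IsCompact anglePairs := by
  refine ((isCompact_Icc (a := (0 : ℝ)) (b := 2 * Real.pi)).prod
    (isCompact_Icc (a := (0 : ℝ)) (b := 4 * Real.pi))).of_isClosed_subset ?_ ?_
  · exact (isClosed_Icc.preimage continuous_fst).inter
      ((isClosed_le continuous_fst continuous_snd).inter
        (isClosed_le continuous_snd (continuous_fst.add continuous_const)))
  · rintro p ⟨h1, h2, h3⟩
    exact ⟨h1, h1.1.trans h2, by linarith [h1.2]⟩

theorem arcLen_eq_sub {p : ℝ × ℝ} (hp : p ∈ anglePairs) :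
    arcLen Φ p.1 p.2 = arcLen Φ 0 p.2 - arcLen Φ 0 p.1 := by
  rw [← arcLen_add Φ hp.1.1 hp.2.1]; ring

theorem continuousOn_arcLen : ContinuousOn (fun p : ℝ × ℝ ↦ arcLen Φ p.1 p.2) anglePairs := by
  refine ContinuousOn.congr (f := fun p ↦ arcLen Φ 0 p.2 - arcLen Φ 0 p.1) ?_
    fun p hp ↦ arcLen_eq_sub Φ hp
  exact ((continuousOn_arcLen_zero Φ).comp continuous_snd.continuousOn
      fun p hp ↦ hp.1.1.trans hp.2.1).sub
    ((continuousOn_arcLen_zero Φ).comp continuous_fst.continuousOn fun p hp ↦ hp.1.1)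

theorem arcVectors_eq_image (ρ : ℝ) : arcVectors Φ ρ =
    (fun p : ℝ × ℝ ↦ unitPt Φ p.2 - unitPt Φ p.1) ''
      (anglePairs ∩ (fun p ↦ arcLen Φ p.1 p.2) ⁻¹' Iic ρ) := by
  ext w
  constructor
  · rintro ⟨x, y, hxy, hyx, rfl, hL⟩
    obtain ⟨t, ht, h1, h2, h3⟩ := exists_shift_mem_Ico Φ x y 0
    refine ⟨(x + t, y + t), ⟨⟨⟨?_, ?_⟩, ?_, ?_⟩, ?_⟩, ?_⟩
    · linarith [ht.1]
    · linarith [ht.2]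
    · simpa using hxy
    · simp only; linarith
    · simpa only [mem_preimage, mem_Iic, h3] using hL
    · simp only [h1, h2]
  · rintro ⟨p, ⟨⟨-, h1, h2⟩, h3⟩, rfl⟩
    exact ⟨p.1, p.2, h1, h2, rfl, h3⟩

theorem continuous_unitPt_sub : Continuous fun p : ℝ × ℝ ↦ unitPt Φ p.2 - unitPt Φ p.1 :=
  ((continuous_unitPt Φ).comp continuous_snd).sub ((continuous_unitPt Φ).comp continuous_fst)

theorem isClosed_arcVectors (ρ : ℝ) : IsClosed (arcVectors Φ ρ) := by
  rw [arcVectors_eq_image]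
  refine (IsCompact.image ?_ (continuous_unitPt_sub Φ)).isClosed
  exact isCompact_anglePairs.of_isClosed_subset
    ((continuousOn_arcLen Φ).preimage_isClosed_of_isClosed
    isCompact_anglePairs.isClosed isClosed_Iic) inter_subset_left

/-- Arc-distance is an infimum. Compactness of the angle pairs representing `w` supplies a shortest
arc. -/
theorem mem_arcVectors_of_forall_gt {ρ : ℝ} {w : E} (h : ∀ ρ' > ρ, w ∈ arcVectors Φ ρ') :
    w ∈ arcVectors Φ ρ := by
  have hcomp : IsCompact (anglePairs ∩ (fun p ↦ unitPt Φ p.2 - unitPt Φ p.1) ⁻¹' {w}) :=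
    isCompact_anglePairs.inter_right (isClosed_singleton.preimage (continuous_unitPt_sub Φ))
  have hex : ∀ ρ' > ρ, ∃ p ∈ anglePairs ∩ (fun p ↦ unitPt Φ p.2 - unitPt Φ p.1) ⁻¹' {w},
      arcLen Φ p.1 p.2 ≤ ρ' := fun ρ' hρ' ↦ by
    have := h ρ' hρ'
    rw [arcVectors_eq_image] at this
    obtain ⟨p, ⟨h1, h2⟩, h3⟩ := this
    exact ⟨p, ⟨h1, h3⟩, h2⟩
  obtain ⟨p₀, hp₀, -⟩ := hex (ρ + 1) (by linarith)
  obtain ⟨p, hp, hmin⟩ := hcomp.exists_isMinOn ⟨p₀, hp₀⟩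
    ((continuousOn_arcLen Φ).mono inter_subset_left)
  refine ⟨p.1, p.2, hp.1.2.1, hp.1.2.2, hp.2, le_of_forall_gt_imp_ge_of_dense fun ρ' hρ' ↦ ?_⟩
  obtain ⟨q, hq, hL⟩ := hex ρ' hρ'
  exact (hmin hq).trans hL

theorem convex_arcVectors {ρ : ℝ} (hρ : 0 ≤ ρ) : Convex ℝ (arcVectors Φ ρ) := by
  intro z₁ h₁ z₂ h₂ a b ha hb hab
  set w := a • z₁ + b • z₂ with hw
  have hw2 : ‖w‖ ≤ 2 := by
    have n₁ := norm_le_two_of_mem_arcVectors Φ h₁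
    have n₂ := norm_le_two_of_mem_arcVectors Φ h₂
    calc ‖w‖ ≤ a * ‖z₁‖ + b * ‖z₂‖ := by
          refine (norm_add_le _ _).trans_eq ?_
          rw [norm_smul, norm_smul, Real.norm_of_nonneg ha, Real.norm_of_nonneg hb]
      _ ≤ a * 2 + b * 2 := by gcongr
      _ = 2 := by rw [← add_mul, hab, one_mul]
  -- Scaling by `τ < 1` makes the norm less than 2, so separation applies. A functional separating
  -- `τ • w` is positive there, by comparison with 0, yet at least `f w`, by comparison with `z₁`
  -- and `z₂`; this is impossible for `τ < 1`.
  have hstar : Ico (0 : ℝ) 1 ⊆ {τ : ℝ | τ • w ∈ arcVectors Φ ρ} := by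
    rintro τ ⟨h0, h1⟩
    by_contra hτ
    have hτ2 : ‖τ • w‖ < 2 := by
      rw [norm_smul, Real.norm_of_nonneg h0]
      nlinarith [norm_nonneg w]
    obtain ⟨f, hf⟩ := exists_separating_of_notMem Φ hρ hτ2 hτ
    have f0 := hf 0 (zero_mem_arcVectors Φ hρ)
    have f₁ := hf _ h₁
    have f₂ := hf _ h₂
    rw [map_zero] at f0
    have hfw : f w ≤ f (τ • w) := by
      calc f w = a * f z₁ + b * f z₂ := by simp [hw]
        _ ≤ a * f (τ • w) + b * f (τ • w) := by gcongr
        _ = f (τ • w) := by rw [← add_mul, hab, one_mul]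
    rw [map_smul, smul_eq_mul] at f0 hfw
    nlinarith
  have hcl : IsClosed {τ : ℝ | τ • w ∈ arcVectors Φ ρ} :=
    (isClosed_arcVectors Φ ρ).preimage (continuous_id.smul continuous_const)
  have := hcl.closure_subset_iff.2 hstar
  rw [closure_Ico zero_ne_one] at this
  simpa using this (right_mem_Icc.2 zero_le_one)

end ArcVectors

/-! ### Injective arcs and their angle lifts -/

section Lift

variable {E : Type*} [NormedAddCommGroup E] [NormedSpace ℝ E] (Φ : E ≃L[ℝ] ℂ)

theorem exists_continuous_angle {γ : ℝ → E} (hγ : Continuous γ) (h1 : ∀ t, ‖γ t‖ = 1) :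
    ∃ θ : ℝ → ℝ, Continuous θ ∧ ∀ t, unitPt Φ (θ t) = γ t := by
  have h0 : ∀ t, ‖Φ (γ t)‖ ≠ 0 := fun t ↦ by
    have : γ t ≠ 0 := norm_pos_iff.1 (by rw [h1]; norm_num)
    simpa using this
  have hmem : ∀ t, Φ (γ t) / (‖Φ (γ t)‖ : ℂ) ∈ Submonoid.unitSphere ℂ := fun t ↦
    mem_sphere_zero_iff_norm.2 (by rw [norm_div, Complex.norm_real, norm_norm, div_self (h0 t)])
  have hcont : Continuous fun t ↦ Φ (γ t) / (‖Φ (γ t)‖ : ℂ) :=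
    (Φ.continuous.comp hγ).div (Complex.continuous_ofReal.comp (Φ.continuous.comp hγ).norm)
      fun t ↦ Complex.ofReal_ne_zero.2 (h0 t)
  let g : C(ℝ, Circle) := ⟨fun t ↦ ⟨_, hmem t⟩, hcont.subtype_mk hmem⟩
  obtain ⟨θ, ⟨-, hθ⟩, -⟩ := Circle.isCoveringMap_exp.existsUnique_continuousMap_lifts g 0
    (Complex.arg (g 0)) (Circle.exp_arg _)
  refine ⟨θ, θ.continuous, fun t ↦ unitPt_eq_of_norm_eq_one Φ (h1 t) _ ?_⟩
  have h2 : (Circle.exp (θ t) : ℂ) = Φ (γ t) / ‖Φ (γ t)‖ := congrArg Subtype.val (congrFun hθ t)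
  rw [Circle.coe_exp] at h2
  rw [h2, mul_div_cancel₀ _ (Complex.ofReal_ne_zero.2 (h0 t))]

theorem exists_arc_of_injOn {γ : ℝ → E} {a b : ℝ} {z : E} (hab : a ≤ b)
    (hγ : ContinuousOn γ (Icc a b)) (hinj : InjOn γ (Icc a b))
    (h1 : ∀ t ∈ Icc a b, ‖γ t - z‖ = 1) :
    ∃ x y, x ≤ y ∧ y ≤ x + 2 * Real.pi ∧ unitPt Φ y - unitPt Φ x = γ b - γ a ∧
      eVariationOn (unitPt Φ) (Icc x y) = eVariationOn γ (Icc a b) := by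
  obtain ⟨θ, hθ, hθγ⟩ := exists_continuous_angle Φ (γ := fun t ↦ γ (projIcc a b hab t) - z)
    ((hγ.comp_continuous (continuous_subtype_val.comp continuous_projIcc)
      fun t ↦ (projIcc a b hab t).2).sub continuous_const)
    fun t ↦ h1 _ (projIcc a b hab t).2
  replace hθγ : ∀ t ∈ Icc a b, unitPt Φ (θ t) = γ t - z := fun t ht ↦ by
    rw [hθγ, projIcc_of_mem hab ht]
  have ha := left_mem_Icc.2 hab
  have hb := right_mem_Icc.2 hab
  have hθinj : InjOn (fun t ↦ unitPt Φ (θ t)) (Icc a b) := fun s hs t ht hst ↦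
    hinj hs ht (by simpa only [hθγ s hs, hθγ t ht, sub_left_inj] using hst)
  have hvar : eVariationOn (unitPt Φ ∘ θ) (Icc a b) = eVariationOn γ (Icc a b) := by
    rw [eVariationOn.congr (f := unitPt Φ ∘ θ) (g := fun t ↦ γ t - z) fun t ht ↦ hθγ t ht]
    simp only [eVariationOn, edist_sub_right]
  have hno : ∀ s ∈ Icc a b, ∀ t ∈ Icc a b, θ t ≤ θ s + 2 * Real.pi := by
    intro s hs t ht
    by_contra! hlt
    -- An angle spread above a full turn would take some value exactly one turn past `θ s`,
    -- repeating a point of the arc.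
    obtain ⟨r, hr, hr'⟩ := intermediate_value_uIcc (a := s) (b := t) hθ.continuousOn
      (mem_uIcc_of_le (by linarith [Real.pi_pos]) hlt.le)
    have hr'' : r ∈ Icc a b := ordConnected_Icc.uIcc_subset hs ht hr
    have : r = s := hθinj hr'' hs (by simp only [hr', unitPt_periodic Φ _])
    rw [this] at hr'
    linarith [Real.pi_pos]
  have hsub : unitPt Φ (θ b) - unitPt Φ (θ a) = γ b - γ a := by
    rw [hθγ _ ha, hθγ _ hb]; abel
  have hθinj' : InjOn θ (Icc a b) := fun s hs t ht hst ↦ hθinj hs ht (by simp only [hst])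
  rcases hθ.continuousOn.strictMonoOn_of_injOn_Icc' hab hθinj' with hm | hm
  · refine ⟨θ a, θ b, hm.monotoneOn ha hb hab, hno a ha b hb, hsub, ?_⟩
    have himg : θ '' Icc a b = Icc (θ a) (θ b) :=
      Subset.antisymm (image_subset_iff.2 fun t ht ↦
        ⟨hm.monotoneOn ha ht ht.1, hm.monotoneOn ht hb ht.2⟩)
        (intermediate_value_Icc hab hθ.continuousOn)
    rw [← hvar, eVariationOn.comp_eq_of_monotoneOn _ _ hm.monotoneOn, himg]
  · have hle := hm.antitoneOn ha hb hab
    -- A decreasing angle traces the arc clockwise. The antipodal arc traced counterclockwise has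
    -- the same length and the same endpoint difference.
    refine ⟨θ b + Real.pi, θ a + Real.pi, by linarith, by linarith [hno b hb a ha], ?_, ?_⟩
    · rw [unitPt_add_pi, unitPt_add_pi, ← hsub]; abel
    have himg : θ '' Icc a b = Icc (θ b) (θ a) :=
      Subset.antisymm (image_subset_iff.2 fun t ht ↦
        ⟨hm.antitoneOn ht hb ht.2, hm.antitoneOn ha ht ht.1⟩)
        (intermediate_value_Icc' hab hθ.continuousOn)
    rw [← ofReal_arcLen, arcLen_add_pi, ofReal_arcLen, ← hvar,
      eVariationOn.comp_eq_of_antitoneOn _ _ hm.antitoneOn, himg]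

theorem exists_injOn_of_arc {x y : ℝ} (hxy : x ≤ y) (hyx : y ≤ x + 2 * Real.pi) :
    ∃ (γ : ℝ → E) (a b : ℝ) (z : E), a ≤ b ∧ Continuous γ ∧ InjOn γ (Icc a b) ∧ γ a = 0 ∧
      γ b = unitPt Φ y - unitPt Φ x ∧ (∀ t, ‖γ t - z‖ = 1) ∧
      eVariationOn γ (Icc a b) ≤ eVariationOn (unitPt Φ) (Icc x y) := by
  rcases hyx.eq_or_lt with rfl | hlt
  -- A full turn is not injective, but its endpoint difference is zero, so the one-point arc
  -- replaces it; any unit vector can serve as center.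
  · refine ⟨fun _ ↦ 0, 0, 0, unitPt Φ 0, le_rfl, continuous_const, by simp, rfl, ?_, ?_, ?_⟩
    · rw [unitPt_periodic, sub_self]
    · intro t
      rw [zero_sub, norm_neg, norm_unitPt]
    · rw [eVariationOn.subsingleton _ (by simp)]
      exact zero_le
  · refine ⟨fun t ↦ unitPt Φ t - unitPt Φ x, x, y, -unitPt Φ x, hxy,
      (continuous_unitPt Φ).sub continuous_const, ?_, sub_self _, rfl, ?_, ?_⟩
    -- Equal points less than a full turn apart have vanishing cross product, so they would be
    -- antipodal, hence zero.
    · have key : ∀ s t, s ∈ Icc x y → t ∈ Icc x y → s < t → unitPt Φ s ≠ unitPt Φ t := by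
        intro s t hs ht hst heq
        have hst' : t < s + 2 * Real.pi := by linarith [hs.1, ht.2]
        have hc := planeCross_unitPt Φ s t
        rw [heq, planeCross_self] at hc
        have hsin : Real.sin (t - s) = 0 := by
          have h1 := (norm_ray_pos Φ s).ne'
          have h2 := (norm_ray_pos Φ t).ne'
          simpa [h1, h2] using hc.symm
        have : t = s + Real.pi := by
          rcases lt_trichotomy (t - s) Real.pi with h | h | h
          · exact absurd hsin (Real.sin_pos_of_pos_of_lt_pi (by linarith) h).ne'
          · linarith
          · have h3 : Real.sin (t - s - 2 * Real.pi) < 0 :=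
              Real.sin_neg_of_neg_of_neg_pi_lt (by linarith) (by linarith)
            rw [Real.sin_sub_two_pi] at h3
            exact absurd hsin h3.ne
        rw [this, unitPt_add_pi, eq_neg_iff_add_eq_zero, ← two_smul ℝ] at heq
        have h4 := congrArg norm heq
        rw [norm_smul, norm_unitPt, norm_zero] at h4
        norm_num at h4
      intro s hs t ht hst
      simp only [sub_left_inj] at hst
      rcases lt_trichotomy s t with h | h | h
      · exact absurd hst (key s t hs ht h)
      · exact h
      · exact absurd hst.symm (key t s ht hs h)
    · intro t
      rw [sub_neg_eq_add, sub_add_cancel, norm_unitPt]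
    · simp only [eVariationOn, edist_sub_right]
      exact le_rfl

end Lift

/-! ### From the gauge of `C` to a normed plane -/

section Gauge

variable {E : Type*} [NormedAddCommGroup E] [NormedSpace ℝ E]

theorem cLength_eq_eVariationOn {C : Set Plane} (ι : Plane ≃ₗ[ℝ] E) (hι : ∀ p, ‖ι p‖ = gauge C p)
    (γ : ℝ → Plane) (a b : ℝ) : cLength C γ a b = eVariationOn (fun t ↦ ι (γ t)) (Icc a b) := by
  have h : ∀ p q, ENNReal.ofReal (cDist C p q) = edist (ι q) (ι p) := fun p q ↦ by
    rw [edist_dist, dist_eq_norm, ← map_sub, hι, cDist]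
  simp only [cLength, eVariationOn, h, iSup_prod, iSup_subtype, iSup_and]

theorem mem_frontier_vadd_iff {C : Set Plane} (hconv : Convex ℝ C) (h0 : C ∈ nhds 0)
    (ι : Plane ≃ₗ[ℝ] E) (hι : ∀ p, ‖ι p‖ = gauge C p) (y p : Plane) :
    p ∈ frontier (y +ᵥ C) ↔ ‖ι p - ι y‖ = 1 := by
  have : frontier (y +ᵥ C) = y +ᵥ frontier C :=
    ((Homeomorph.vadd y).image_frontier C).symm
  rw [this, ← map_sub, hι, gauge_eq_one_iff_mem_frontier hconv h0,
    mem_vadd_set_iff_neg_vadd_mem, vadd_eq_add, neg_add_eq_sub]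

/-- Forward, a nearly optimal arc is lifted to angles for each `ρ' > ρ`, and the limit is taken by
compactness. Backward, the arc of the unit circle is translated to start at the origin, and the
bound 2 on the norm is automatic for a difference of unit vectors. -/
theorem mem_arcDisk_iff {C : Set Plane} (hconv : Convex ℝ C) (h0 : C ∈ nhds 0)
    (ι : Plane ≃ₗ[ℝ] E) (hι : ∀ p, ‖ι p‖ = gauge C p) (Φ : E ≃L[ℝ] ℂ) {ρ : ℝ} (hρ : 0 ≤ ρ)
    (w : Plane) : w ∈ arcDisk C 0 ρ ↔ ι w ∈ arcVectors Φ ρ := by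
  have : FiniteDimensional ℝ E := ι.finiteDimensional
  have hιc : Continuous ι := ι.toLinearMap.continuous_of_finiteDimensional
  have hιc' : Continuous ι.symm := ι.symm.toLinearMap.continuous_of_finiteDimensional
  constructor
  · rintro ⟨-, hw⟩
    refine mem_arcVectors_of_forall_gt Φ fun ρ' hρ' ↦ ?_
    have hlt : arcDist C 0 w < ENNReal.ofReal ρ' :=
      hw.trans_lt ((ENNReal.ofReal_lt_ofReal_iff (hρ.trans_lt hρ')).2 hρ')
    simp only [arcDist, iInf_lt_iff] at hlt
    obtain ⟨y, γ, a, b, hγ, hL⟩ := hlt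
    obtain ⟨s, t, hst, hts, he, hv⟩ := exists_arc_of_injOn Φ (γ := fun t ↦ ι (γ t)) (z := ι y)
      hγ.le (hιc.comp_continuousOn hγ.continuousOn) (ι.injective.comp_injOn hγ.injOn)
      fun t ht ↦ (mem_frontier_vadd_iff hconv h0 ι hι y _).1 (hγ.mapsTo ht)
    refine ⟨s, t, hst, hts, ?_, ?_⟩
    · rw [he, hγ.source, hγ.target, map_zero, sub_zero]
    · rw [cLength_eq_eVariationOn ι hι, ← hv] at hL
      exact ENNReal.toReal_le_of_le_ofReal (hρ.trans hρ'.le) hL.le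
  · intro hw
    have h2 := norm_le_two_of_mem_arcVectors Φ hw
    obtain ⟨s, t, hst, hts, he, hL⟩ := hw
    refine ⟨by rwa [cDist, sub_zero, ← hι], ?_⟩
    obtain ⟨γ, a, b, z, hab, hc, hinj, ha, hb, hz, hv⟩ := exists_injOn_of_arc Φ hst hts
    have harc : IsArcIn (frontier (ι.symm z +ᵥ C)) (fun t ↦ ι.symm (γ t)) a b 0 w :=
      { le := hab
        continuousOn := (hιc'.comp hc).continuousOn
        injOn := ι.symm.injective.comp_injOn hinj
        source := by rw [ha, map_zero]
        target := by rw [hb, he, ι.symm_apply_apply]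
        mapsTo := fun t _ ↦ by
          rw [mem_frontier_vadd_iff hconv h0 ι hι, ι.apply_symm_apply, ι.apply_symm_apply]
          exact hz t }
    calc arcDist C 0 w ≤ cLength C (fun t ↦ ι.symm (γ t)) a b :=
          iInf_le_of_le _ <| iInf_le_of_le _ <| iInf_le_of_le _ <| iInf_le_of_le _ <|
            iInf_le _ harc
      _ = eVariationOn γ (Icc a b) := by
          simp only [cLength_eq_eVariationOn ι hι, ι.apply_symm_apply]
      _ ≤ ENNReal.ofReal (arcLen Φ s t) := by rwa [ofReal_arcLen]
      _ ≤ ENNReal.ofReal ρ := ENNReal.ofReal_le_ofReal hL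

/-- The plane, to be normed by the gauge of `C`. -/
def GaugePlane (_ : Set Plane) : Type := Plane

noncomputable instance (C : Set Plane) : AddCommGroup (GaugePlane C) :=
  inferInstanceAs (AddCommGroup Plane)

noncomputable instance (C : Set Plane) : Module ℝ (GaugePlane C) :=
  inferInstanceAs (Module ℝ Plane)

/-- The identity map of the plane onto the plane normed by the gauge of `C`. -/
noncomputable def toGaugePlane (C : Set Plane) : Plane ≃ₗ[ℝ] GaugePlane C :=
  LinearEquiv.refl ℝ Plane

noncomputable instance (C : Set Plane) : Norm (GaugePlane C) :=
  ⟨fun x ↦ gauge C ((toGaugePlane C).symm x)⟩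

theorem norm_toGaugePlane (C : Set Plane) (p : Plane) : ‖toGaugePlane C p‖ = gauge C p := rfl

theorem gaugePlane_core {C : Set Plane} (hconv : Convex ℝ C) (hcomp : IsCompact C)
    (h0 : C ∈ nhds 0) (hsymm : ∀ x ∈ C, -x ∈ C) : NormedSpace.Core ℝ (GaugePlane C) where
  norm_nonneg x := gauge_nonneg _
  norm_smul r x := by
    change gauge C (r • (toGaugePlane C).symm x) = _
    rcases abs_choice r with h | h
    · rw [← h, gauge_smul_of_nonneg (abs_nonneg r), Real.norm_eq_abs, abs_abs]
      rfl
    · rw [← gauge_neg hsymm, ← neg_smul, ← h, gauge_smul_of_nonneg (abs_nonneg r)]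
      rfl
  norm_triangle x y := gauge_add_le hconv (absorbent_nhds_zero h0) _ _
  norm_eq_zero_iff x := by
    refine (gauge_eq_zero (absorbent_nhds_zero h0)
      ((NormedSpace.isVonNBounded_iff ℝ).2 hcomp.isBounded)).trans ?_
    simp

theorem mem_nhds_zero_of_symm {C : Set Plane} (hconv : Convex ℝ C)
    (hint : (interior C).Nonempty) (hsymm : ∀ x ∈ C, -x ∈ C) : C ∈ nhds 0 := by
  obtain ⟨x, hx⟩ := hint
  rw [← mem_interior_iff_mem_nhds]
  -- The origin is the midpoint of an interior point and its reflection.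
  have h := hconv.combo_interior_self_mem_interior hx (hsymm x (interior_subset hx))
    (a := 1 / 2) (b := 1 / 2) (by norm_num) (by norm_num) (by norm_num)
  simpa using h

end Gauge

theorem mainTheorem7 (C : Set Plane) (hconv : Convex ℝ C) (hcomp : IsCompact C)
    (hint : (interior C).Nonempty) (hsymm : ∀ x ∈ C, -x ∈ C)
    (ρ : ℝ) (hρ0 : 0 ≤ ρ) (hρ : ENNReal.ofReal ρ ≤ perim C C / 2) :
    Convex ℝ (arcDisk C 0 ρ) := by
  have h0 := mem_nhds_zero_of_symm hconv hint hsymm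
  have core := gaugePlane_core hconv hcomp h0 hsymm
  let _ : NormedAddCommGroup (GaugePlane C) := NormedAddCommGroup.ofCore core
  let _ : NormedSpace ℝ (GaugePlane C) := NormedSpace.ofCore core
  have : FiniteDimensional ℝ (GaugePlane C) := (toGaugePlane C).finiteDimensional
  let Φ : GaugePlane C ≃L[ℝ] ℂ := ContinuousLinearEquiv.ofFinrankEq <| by
    rw [← (toGaugePlane C).finrank_eq, Complex.finrank_real_complex, finrank_euclideanSpace_fin]
  have h : arcDisk C 0 ρ = (toGaugePlane C).toLinearMap ⁻¹' arcVectors Φ ρ :=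
    Set.ext fun w ↦ mem_arcDisk_iff hconv h0 (toGaugePlane C) (norm_toGaugePlane C) Φ hρ0 w
  rw [h]
  exact (convex_arcVectors Φ hρ0).linear_preimage _
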